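/- A represented space is a set $X$ with a surjective partial map $\delta_X:\subseteq\mathbb N^{\mathbb N}\to X$; $p$ is a name of $x$ if $\delta_X(p)=x$. A partial function $F$ on $\mathbb N^{\mathbb N}$ realizes a partial multivalued map $f:\subseteq X\rightrightarrows Y$ if $\delta_Y(F(p))\in f(\delta_X(p))$ for all $p$ with $\delta_X(p)\in\mathrm{dom}(f)$; $f$ is computable if it has a computable realizer. A computable embedding is an injective computable map whose partial inverse is computable. A computably surjective map is a surjective computable map that has a computable multivalued inverse. $\mathbb S=\{0,1\}$ is Sierpiński space, where the zero sequence is the only name of $0$ and every other sequence is a name of $1$. $\mathcal O(X)$ is the set of open sets in the final topology of $\delta_X$, where a name of $U$ is a name of its characteristic function $X\to\mathbb S$ in the standard function space representation (that is, an associate of a realizer). $\mathcal K_-(Y)$ is the space of saturated compact sets $K\subseteq Y$, a name of $K$ being a name of $\forall_K:\mathcal O(Y)\to\mathbb S$, the characteristic function of $\{U: K\subseteq U\}$; $\mathcal A_+(Y)$ is the space of closed sets $A\subseteq Y$, a name of $A$ being a name of $\exists_A:\mathcal O(Y)\to\mathbb S$, the characteristic function of $\{U: A\cap U\neq\emptyset\}$.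 Let $X$, $Y$ be represented spaces and let $B:Y\to\mathcal O(X)$, $y\mapsto B_y$. - $X$ is a computable Kolmogorov space if $\mathcal U:X\to\mathcal O\mathcal O(X)$, $x\mapsto\{U\in\mathcal O(X):x\in U\}$, is a computable embedding. - $B$ is a computable presubbase of $X$ if $x\mapsto\{y\in Y:x\in B_y\}$ is a well-defined map $X\to\mathcal O(Y)$ and a computable embedding. - $B$ is a computable prebase of $X$ if it is a computable presubbase, $X=\bigcup_{y\in Y}B_y$, and there is a total computable multivalued $R:\mathcal K_-(Y)\rightrightarrows\mathcal A_+(Y)$ with $\bigcap_{y\in K}B_y=\bigcup_{y\in A}B_y$ for all $K\in\mathcal K_-(Y)$ and $A\in R(K)$ (the empty intersection being $X$). - $B$ is a computable base of $X$ if it is a computable prebase and $\{B_y:y\in Y\}$ is a base of the final topology of $X$. - $B$ is a computable Lacombe base of $X$ if $X$ is a computable Kolmogorov space and $\mathcal A_+(Y)\to\mathcal O(X)$, $A\mapsto\bigcup_{y\in A}B_y$, is computably surjective. **Theorem.** For every represented space $X$ the following are equivalent: 1. $X$ is a computable Kolmogorov space. 2. $X$ has a computable presubbase (that is, there are a represented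 space $Y$ and a computable presubbase $B:Y\to\mathcal O(X)$ of $X$; likewise below). 3. $X$ has a computable prebase. 4. $X$ has a computable base. 5. $X$ has a computable Lacombe base. 6. $\mathrm{id}:\mathcal O(X)\to\mathcal O(X)$ is a computable Lacombe base of $X$. -/

import Mathlib

open TopologicalSpace Set

universe u v

namespace CompTop

/-- Baire space, with the product topology of discrete copies of `ℕ`. -/
abbrev Baire : Type := ℕ → ℕ

/-- The initial segment `q 0, …, q (k - 1)`. -/
def initSeg (q : Baire) (k : ℕ) : List ℕ := (List.range k).map q

/-- The natural number that codes the query `(n, q 0 … q (k - 1))`. -/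
def query (n : ℕ) (q : Baire) (k : ℕ) : ℕ := Encodable.encode (n, initSeg q k)

/-- The partial continuous function with Kleene associate `a`: the `n`-th value on input `q` is
`m` if `a` answers `m + 1` to the shortest initial segment of `q` (queried together with `n`) on
which its answer is not `0`. This is the application of Kleene's second algebra. -/
def kleeneApp (a : Baire) : Baire →. Baire := fun q =>
  ⟨∀ n, ∃ k, a (query n q k) ≠ 0, fun h n => a (query n q (Nat.find (h n))) - 1⟩

/-- A partial function on Baire space is computable if it is a restriction of a partial function
with a computable Kleene associate. -/
def BaireComputable (F : Baire →. Baire) : Prop :=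
  ∃ a : Baire, Computable a ∧ ∀ p r, r ∈ F p → r ∈ kleeneApp a p

/-- A represented space: a set with a surjective partial map from Baire space. -/
structure RepSpace : Type (u + 1) where
  carrier : Type u
  rep : Baire →. carrier
  surj : ∀ x, ∃ p, x ∈ rep p

instance : CoeSort RepSpace.{u} (Type u) := ⟨RepSpace.carrier⟩

/-- The final topology of the representation. -/
instance RepSpace.instTopologicalSpace (X : RepSpace.{u}) : TopologicalSpace X.carrier :=
  TopologicalSpace.coinduced (fun p : X.rep.Dom => X.rep.fn p.1 p.2) inferInstance

/-- `F` realizes the (partial) multivalued map `f`, whose domain is `{x | (f x).Nonempty}`. -/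
def RealizesMulti {X : RepSpace.{u}} {Y : RepSpace.{v}} (F : Baire →. Baire) (f : X → Set Y) :
    Prop :=
  ∀ p, ∀ x ∈ X.rep p, (f x).Nonempty → ∃ r ∈ F p, ∃ y ∈ Y.rep r, y ∈ f x

/-- A partial multivalued map is computable if it has a computable realizer. -/
def ComputableMulti {X : RepSpace.{u}} {Y : RepSpace.{v}} (f : X → Set Y) : Prop :=
  ∃ F : Baire →. Baire, BaireComputable F ∧ RealizesMulti F f

/-- `F` realizes the single-valued total map `f`. -/
def Realizes {X : RepSpace.{u}} {Y : RepSpace.{v}} (F : Baire →. Baire) (f : X → Y) : Prop :=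
  RealizesMulti F (fun x => ({f x} : Set Y))

/-- A single-valued total map is computable if it has a computable realizer. -/
def ComputableMap {X : RepSpace.{u}} {Y : RepSpace.{v}} (f : X → Y) : Prop :=
  ComputableMulti (fun x => ({f x} : Set Y))

/-- The inverse of `f` as a partial multivalued map, with domain the range of `f`. -/
def inverse {X : Type u} {Y : Type v} (f : X → Y) : Y → Set X := fun y => {x | f x = y}

/-- A computable embedding: injective and computable, with computable partial inverse. -/
def ComputableEmbedding {X : RepSpace.{u}} {Y : RepSpace.{v}} (f : X → Y) : Prop :=
  Function.Injective f ∧ ComputableMap f ∧ ComputableMulti (inverse f)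

/-- A computably surjective map: surjective and computable, with computable multivalued inverse. -/
def ComputablySurjective {X : RepSpace.{u}} {Y : RepSpace.{v}} (f : X → Y) : Prop :=
  Function.Surjective f ∧ ComputableMap f ∧ ComputableMulti (inverse f)

/-- Sierpiński space on the truth values; the only name of `False` is the zero sequence. -/
def sierpinski : RepSpace.{0} where
  carrier := Prop
  rep := fun p => Part.some (∃ n, p n ≠ 0)
  surj := by
    intro P
    by_cases h : P
    · exact ⟨fun _ => 1, by simp [h]⟩
    · exact ⟨fun _ => 0, by simp [h]⟩

/-- `p` is a name of the characteristic function `f : X → 𝕊` in the function space representation: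
the partial function with associate `p` realizes `f`. -/
def NamesChar {X : RepSpace.{u}} (p : Baire) (f : X → Prop) : Prop :=
  Realizes (Y := sierpinski) (kleeneApp p) f

/-- The partial map whose graph is the relation `R`. -/
noncomputable def partialOfRel {α : Type u} (R : Baire → α → Prop) : Baire →. α :=
  fun p => ⟨∃ x, R p x, fun h => h.choose⟩

theorem mem_partialOfRel {α : Type u} {R : Baire → α → Prop}
    (hR : ∀ p x y, R p x → R p y → x = y) {p : Baire} {x : α} :
    x ∈ partialOfRel R p ↔ R p x := by
  constructor
  · rintro ⟨h, rfl⟩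
    exact h.choose_spec
  · intro h
    exact ⟨⟨x, h⟩, hR _ _ _ (Exists.choose_spec (⟨x, h⟩ : ∃ x, R p x)) h⟩

theorem namesChar_iff {X : RepSpace.{u}} {p : Baire} {f : X → Prop} :
    NamesChar p f ↔ ∀ q, ∀ x ∈ X.rep q, ∃ r ∈ kleeneApp p q, ((∃ n, r n ≠ 0) ↔ f x) := by
  constructor
  · intro h q x hx
    obtain ⟨r, hr, y, hy, hyf⟩ := h q x hx ⟨_, rfl⟩
    refine ⟨r, hr, ?_⟩
    have h1 : y = (∃ n, r n ≠ 0) := Part.mem_some_iff.1 hy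
    have h2 : y = f x := hyf
    exact iff_of_eq (h1.symm.trans h2)
  · intro h q x hx _
    obtain ⟨r, hr, hf⟩ := h q x hx
    exact ⟨r, hr, _, Part.mem_some _, propext hf⟩

theorem namesChar_unique {X : RepSpace.{u}} {p : Baire} {f g : X → Prop}
    (hf : NamesChar p f) (hg : NamesChar p g) : f = g := by
  funext x
  obtain ⟨q, hq⟩ := X.surj x
  obtain ⟨r, hr, h1⟩ := namesChar_iff.1 hf q x hq
  obtain ⟨s, hs, h2⟩ := namesChar_iff.1 hg q x hq
  obtain rfl := Part.mem_unique hr hs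
  exact propext (h1.symm.trans h2)

theorem isOpen_baire_iff {s : Set Baire} :
    IsOpen s ↔ ∀ q ∈ s, ∃ k, ∀ q' : Baire, (∀ i < k, q' i = q i) → q' ∈ s := by
  constructor
  · intro hs q hq
    obtain ⟨I, t, hI, hsub⟩ := isOpen_pi_iff.1 hs q hq
    refine ⟨I.sup id + 1, fun q' h => hsub fun i hi => ?_⟩
    have : i ≤ I.sup id := Finset.le_sup (f := id) hi
    rw [h i (by omega)]
    exact (hI i hi).2
  · intro h
    refine isOpen_pi_iff.2 fun q hq => ?_
    obtain ⟨k, hk⟩ := h q hq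
    refine ⟨Finset.range k, fun i => {q i}, fun i _ => ⟨isOpen_discrete _, rfl⟩, fun q' hq' => ?_⟩
    exact hk q' fun i hi => hq' i (by simpa using hi)

/-- A set is open in the final topology iff membership of a point is witnessed by an initial
segment of each of its names. -/
theorem isOpen_iff {X : RepSpace.{u}} {U : Set X} :
    IsOpen U ↔ ∀ q, ∀ x ∈ X.rep q, x ∈ U →
      ∃ k, ∀ q', (∀ i < k, q' i = q i) → ∀ x' ∈ X.rep q', x' ∈ U := by
  rw [isOpen_coinduced, isOpen_induced_iff]
  constructor
  · rintro ⟨t, ht, h⟩ q x hx hxU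
    have hd : q ∈ X.rep.Dom := Part.dom_iff_mem.2 ⟨x, hx⟩
    have hq : q ∈ t := by
      have : (⟨q, hd⟩ : X.rep.Dom) ∈ Subtype.val ⁻¹' t := by
        rw [h]
        have h0 : X.rep.fn q hd = x := Part.get_eq_of_mem hx hd
        change X.rep.fn q hd ∈ U
        rwa [h0]
      exact this
    obtain ⟨k, hk⟩ := isOpen_baire_iff.1 ht q hq
    refine ⟨k, fun q' hq' x' hx' => ?_⟩
    have hd' : q' ∈ X.rep.Dom := Part.dom_iff_mem.2 ⟨x', hx'⟩
    have h3 : (⟨q', hd'⟩ : X.rep.Dom) ∈ Subtype.val ⁻¹' t := hk q' hq'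
    rw [h] at h3
    have h4 : X.rep.fn q' hd' = x' := Part.get_eq_of_mem hx' hd'
    change X.rep.fn q' hd' ∈ U at h3
    rwa [h4] at h3
  · intro h
    refine ⟨{q | ∃ k, ∀ q', (∀ i < k, q' i = q i) → ∀ x' ∈ X.rep q', x' ∈ U}, ?_, ?_⟩
    · refine isOpen_baire_iff.2 ?_
      rintro q ⟨k, hk⟩
      exact ⟨k, fun q' hq' => ⟨k, fun q'' h'' =>
        hk q'' fun i hi => (h'' i hi).trans (hq' i hi)⟩⟩
    · ext ⟨q, hd⟩
      constructor
      · rintro ⟨k, hk⟩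
        exact hk q (fun _ _ => rfl) _ (Part.get_mem hd)
      · intro hq
        exact h q _ (Part.get_mem hd) hq

theorem initSeg_eq_iff {q q' : Baire} {k : ℕ} :
    initSeg q k = initSeg q' k ↔ ∀ i < k, q i = q' i := by
  simp [initSeg]

theorem mem_kleeneApp {a q r : Baire} :
    r ∈ kleeneApp a q ↔
      ∀ n, ∃ k, a (query n q k) = r n + 1 ∧ ∀ j < k, a (query n q j) = 0 := by
  constructor
  · rintro ⟨h, rfl⟩ n
    refine ⟨Nat.find (h n), ?_, fun j hj => not_not.1 (Nat.find_min (h n) hj)⟩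
    have := Nat.find_spec (h n)
    change _ = a (query n q (Nat.find (h n))) - 1 + 1
    omega
  · intro h
    have hd : ∀ n, ∃ k, a (query n q k) ≠ 0 := fun n => by
      obtain ⟨k, hk, -⟩ := h n
      exact ⟨k, by omega⟩
    refine ⟨hd, funext fun n => ?_⟩
    obtain ⟨k, hk, hmin⟩ := h n
    have : Nat.find (hd n) = k :=
      (Nat.find_eq_iff _).2 ⟨by omega, fun j hj => not_not.2 (hmin j hj)⟩
    change a (query n q (Nat.find (hd n))) - 1 = r n
    rw [this, hk]
    rfl

/-- Characteristic functions of open sets have names. -/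
theorem exists_namesChar {X : RepSpace.{u}} {U : Set X} (hU : IsOpen U) :
    ∃ p, NamesChar p (fun x : X => x ∈ U) := by
  classical
  let W : List ℕ → Prop := fun s => ∀ q', initSeg q' s.length = s → ∀ x' ∈ X.rep q', x' ∈ U
  let a : Baire := fun c =>
    match (Encodable.decode c : Option (ℕ × List ℕ)) with
    | none => 0
    | some (n, s) => if s.length < n then 0 else if W s then 2 else 1
  have ha : ∀ n q k, a (query n q k) =
      if k < n then 0 else if W (initSeg q k) then 2 else 1 := by
    intro n q k
    have : (initSeg q k).length = k := by simp [initSeg]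
    simp only [a, query, Encodable.encodek, this]
  refine ⟨a, namesChar_iff.2 fun q x hx => ?_⟩
  refine ⟨fun n => if W (initSeg q n) then 1 else 0, mem_kleeneApp.2 fun n => ⟨n, ?_, ?_⟩, ?_⟩
  · rw [ha]
    by_cases h : W (initSeg q n) <;> simp [h]
  · intro j hj
    rw [ha]
    simp [hj]
  · have hlen : ∀ n, (initSeg q n).length = n := fun n => by simp [initSeg]
    constructor
    · rintro ⟨n, hn⟩
      have hW : W (initSeg q n) := by
        by_contra h
        simp [h] at hn
      exact hW q (by rw [hlen]) x hx
    · intro hxU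
      obtain ⟨k, hk⟩ := isOpen_iff.1 hU q x hx hxU
      refine ⟨k, ?_⟩
      have hW : W (initSeg q k) := by
        intro q' hq'
        rw [hlen] at hq'
        exact hk q' (initSeg_eq_iff.1 hq')
      simp [hW]

/-- A positive answer of a name `p` on input `q` depends only on finite parts of `p` and `q`. -/
theorem namesChar_locally {X : RepSpace.{u}} {p : Baire} {f : X → Prop} (hp : NamesChar p f)
    {q : Baire} {x : X} (hx : x ∈ X.rep q) (hf : f x) :
    ∃ M, ∀ p', (∀ i < M, p' i = p i) → ∀ g : X → Prop, NamesChar p' g →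
      ∀ q', (∀ i < M, q' i = q i) → ∀ x' ∈ X.rep q', g x' := by
  obtain ⟨r, hr, h⟩ := namesChar_iff.1 hp q x hx
  obtain ⟨n, hn⟩ := h.2 hf
  obtain ⟨k, hk, hmin⟩ := mem_kleeneApp.1 hr n
  refine ⟨k + (Finset.range (k + 1)).sup (fun j => query n q j) + 1,
    fun p' hp' g hg q' hq' x' hx' => ?_⟩
  have key : ∀ j ≤ k, p' (query n q' j) = p (query n q j) := by
    intro j hj
    have h1 : query n q' j = query n q j := by
      simp only [query]
      rw [initSeg_eq_iff.2 fun i hi => hq' i (by omega)]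
    rw [h1]
    have h2 : query n q j ≤ (Finset.range (k + 1)).sup (fun j => query n q j) :=
      Finset.le_sup (f := fun j => query n q j) (Finset.mem_range.2 (by omega))
    exact hp' _ (by omega)
  obtain ⟨r', hr', h'⟩ := namesChar_iff.1 hg q' x' hx'
  refine h'.1 ⟨n, ?_⟩
  obtain ⟨k', hk', hmin'⟩ := mem_kleeneApp.1 hr' n
  have hkk : k' = k := by
    rcases lt_trichotomy k' k with hlt | heq | hlt
    · have := key k' hlt.le
      rw [hmin k' hlt] at this
      omega
    · exact heq
    · have := key k le_rfl
      rw [hmin' k hlt] at this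
      omega
  subst hkk
  have := key k' le_rfl
  omega

theorem namesOpen_unique {X : RepSpace.{u}} (p : Baire) (U V : Opens X)
    (hU : NamesChar p (fun x : X => x ∈ U)) (hV : NamesChar p (fun x : X => x ∈ V)) : U = V := by
  ext x
  exact iff_of_eq (congrFun (namesChar_unique hU hV) x)

/-- The space `𝒪(X)` of open subsets; a name of `U` is a name of its characteristic function. -/
noncomputable def opens (X : RepSpace.{u}) : RepSpace.{u} where
  carrier := Opens X
  rep := partialOfRel fun p U => NamesChar p (fun x : X => x ∈ U)
  surj := fun U => by
    obtain ⟨p, hp⟩ := exists_namesChar U.isOpen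
    exact ⟨p, (mem_partialOfRel namesOpen_unique).2 hp⟩

theorem mem_opens_rep {X : RepSpace.{u}} {p : Baire} {U : Opens X} :
    U ∈ (opens X).rep p ↔ NamesChar p (fun x : X => x ∈ U) :=
  mem_partialOfRel namesOpen_unique

/-- A point of `𝒪(X)` as an open subset of `X`. -/
def asOpens {X : RepSpace.{u}} (U : opens X) : Opens X := U

/-- The saturated compact subsets: those that are the intersection of their open supersets. -/
def SatCompacts (Y : Type u) [TopologicalSpace Y] : Type u :=
  {K : Set Y // IsCompact K ∧ ⋂₀ {U : Set Y | IsOpen U ∧ K ⊆ U} = K}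

/-- The universal quantifier `∀_K` of a set `K`, as the characteristic function of
`{U | K ⊆ U}`. -/
def forallOn {Y : RepSpace.{u}} (K : Set Y) : opens Y → Prop := fun U : Opens Y => K ⊆ (U : Set Y)

/-- The existential quantifier `∃_A` of a set `A`, as the characteristic function of
`{U | (A ∩ U).Nonempty}`. -/
def existsOn {Y : RepSpace.{u}} (A : Set Y) : opens Y → Prop :=
  fun U : Opens Y => (A ∩ (U : Set Y)).Nonempty

theorem isOpen_forallOn {Y : RepSpace.{u}} {K : Set Y} (hK : IsCompact K) :
    IsOpen {U : opens Y | forallOn K U} := by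
  refine isOpen_iff.2 fun p U hpU hKU => ?_
  by_contra hcon
  push Not at hcon
  choose p' hp' V hV hKV using hcon
  have hp : NamesChar p (fun y : Y => y ∈ asOpens U) := mem_opens_rep.1 hpU
  have hpV : ∀ n, NamesChar (p' n) (fun y : Y => y ∈ asOpens (V n)) :=
    fun n => mem_opens_rep.1 (hV n)
  let W : ℕ → Set Y := fun N => {y | y ∈ asOpens U ∧ ∀ n, N ≤ n → y ∈ asOpens (V n)}
  have hloc : ∀ q, ∀ y ∈ Y.rep q, y ∈ asOpens U → ∃ M, ∀ q', (∀ i < M, q' i = q i) →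
      ∀ y' ∈ Y.rep q', y' ∈ W M := by
    intro q y hy hyU
    obtain ⟨M, hM⟩ := namesChar_locally hp hy hyU
    refine ⟨M, fun q' hq' y' hy' => ⟨hM p (fun _ _ => rfl) _ hp q' hq' y' hy', fun n hn => ?_⟩⟩
    exact hM (p' n) (fun i hi => hp' n i (by omega)) _ (hpV n) q' hq' y' hy'
  have hWo : ∀ N, IsOpen (W N) := by
    intro N
    refine isOpen_iff.2 fun q y hy hyW => ?_
    obtain ⟨M, hM⟩ := hloc q y hy hyW.1
    have hfin : IsOpen (⋂ n ∈ Finset.Ico N M, (asOpens (V n) : Set Y)) :=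
      isOpen_biInter_finset fun n _ => (asOpens (V n)).isOpen
    have hyf : y ∈ ⋂ n ∈ Finset.Ico N M, (asOpens (V n) : Set Y) :=
      mem_iInter₂.2 fun n hn => hyW.2 n (Finset.mem_Ico.1 hn).1
    obtain ⟨k, hk⟩ := isOpen_iff.1 hfin q y hy hyf
    refine ⟨max k M, fun q' hq' y' hy' => ?_⟩
    have h1 := hM q' (fun i hi => hq' i (lt_max_of_lt_right hi)) y' hy'
    have h2 := hk q' (fun i hi => hq' i (lt_max_of_lt_left hi)) y' hy'
    refine ⟨h1.1, fun n hn => ?_⟩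
    by_cases hnM : M ≤ n
    · exact h1.2 n hnM
    · exact mem_iInter₂.1 h2 n (Finset.mem_Ico.2 ⟨hn, by omega⟩)
  have hcov : K ⊆ ⋃ N, W N := by
    intro y hy
    obtain ⟨q, hq⟩ := Y.surj y
    obtain ⟨M, hM⟩ := hloc q y hq (hKU hy)
    exact mem_iUnion.2 ⟨M, hM q (fun _ _ => rfl) y hq⟩
  have hdir : Directed (· ⊆ ·) W :=
    directed_of_isDirected_le fun a b hab y hy => ⟨hy.1, fun n hn => hy.2 n (hab.trans hn)⟩
  obtain ⟨N, hN⟩ := hK.elim_directed_cover W hWo hcov hdir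
  exact hKV N fun y hy => (hN hy).2 N le_rfl

theorem isOpen_existsOn {Y : RepSpace.{u}} (A : Set Y) :
    IsOpen {U : opens Y | existsOn A U} := by
  refine isOpen_iff.2 fun p U hpU hAU => ?_
  obtain ⟨y, hyA, hyU⟩ := hAU
  obtain ⟨q, hq⟩ := Y.surj y
  obtain ⟨M, hM⟩ := namesChar_locally (mem_opens_rep.1 hpU) hq hyU
  exact ⟨M, fun p' hp' V hV => ⟨y, hyA, hM p' hp' _ (mem_opens_rep.1 hV) q (fun _ _ => rfl) y hq⟩⟩

theorem namesSatCompact_unique {Y : RepSpace.{u}} (p : Baire) (K L : SatCompacts Y)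
    (hK : NamesChar p (forallOn K.1)) (hL : NamesChar p (forallOn L.1)) : K = L := by
  have h := namesChar_unique hK hL
  have h' : ∀ U : Set Y, IsOpen U → (K.1 ⊆ U ↔ L.1 ⊆ U) := fun U hU =>
    iff_of_eq (congrFun h (⟨U, hU⟩ : Opens Y))
  apply Subtype.ext
  rw [← K.2.2, ← L.2.2]
  congr 1
  ext U
  exact and_congr_right (h' U)

theorem namesClosed_unique {Y : RepSpace.{u}} (p : Baire) (A B : Closeds Y)
    (hA : NamesChar p (existsOn (A : Set Y))) (hB : NamesChar p (existsOn (B : Set Y))) :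
    A = B := by
  have h := namesChar_unique hA hB
  have h' : ∀ U : Set Y, IsOpen U → (((A : Set Y) ∩ U).Nonempty ↔ ((B : Set Y) ∩ U).Nonempty) :=
    fun U hU => iff_of_eq (congrFun h (⟨U, hU⟩ : Opens Y))
  ext y
  have hA' := h' _ A.isClosed.isOpen_compl
  have hB' := h' _ B.isClosed.isOpen_compl
  simp only [inter_compl_self, Set.not_nonempty_empty, false_iff, iff_false] at hA' hB'
  constructor
  · intro hy
    by_contra hn
    exact hB' ⟨y, hy, hn⟩
  · intro hy
    by_contra hn
    exact hA' ⟨y, hy, hn⟩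

/-- The space `𝒦₋(Y)` of saturated compact subsets; a name of `K` is a name of
`∀_K : 𝒪(Y) → 𝕊`. -/
noncomputable def satCompacts (Y : RepSpace.{u}) : RepSpace.{u} where
  carrier := SatCompacts Y
  rep := partialOfRel fun p K => NamesChar p (forallOn K.1)
  surj := fun K => by
    obtain ⟨p, hp⟩ := exists_namesChar (isOpen_forallOn K.2.1)
    exact ⟨p, (mem_partialOfRel namesSatCompact_unique).2 hp⟩

/-- The space `𝒜₊(Y)` of closed subsets; a name of `A` is a name of `∃_A : 𝒪(Y) → 𝕊`. -/
noncomputable def closedsPos (Y : RepSpace.{u}) : RepSpace.{u} where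
  carrier := Closeds Y
  rep := partialOfRel fun p A => NamesChar p (existsOn (A : Set Y))
  surj := fun A => by
    obtain ⟨p, hp⟩ := exists_namesChar (isOpen_existsOn (A : Set Y))
    exact ⟨p, (mem_partialOfRel namesClosed_unique).2 hp⟩

/-- The neighborhood map `x ↦ {U ∈ 𝒪(X) | x ∈ U}`; the set is open because it is the set of open
supersets of the compact set `{x}`. -/
def nhdMap (X : RepSpace.{u}) : X → opens (opens X) := fun x =>
  (⟨{U : opens X | x ∈ asOpens U}, by
    have h := isOpen_forallOn (isCompact_singleton (x := x))
    simp only [forallOn, singleton_subset_iff] at h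
    exact h⟩ : Opens (opens X))

/-- `X` is a computable Kolmogorov space. -/
def ComputableKolmogorov (X : RepSpace.{u}) : Prop := ComputableEmbedding (nhdMap X)

/-- `B : Y → 𝒪(X)` is a computable presubbase of `X`: the transpose `x ↦ {y | x ∈ B y}` is well
defined as a map to `𝒪(Y)` and is a computable embedding. -/
def ComputablePresubbase (X : RepSpace.{u}) (Y : RepSpace.{v}) (B : Y → Opens X) : Prop :=
  ∃ h : ∀ x : X, IsOpen {y : Y | x ∈ B y},
    ComputableEmbedding (X := X) (Y := opens Y)
      (fun x => (⟨{y : Y | x ∈ B y}, h x⟩ : Opens Y))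

/-- `B` is a computable prebase of `X`: a computable presubbase with union `X` for which some total
computable multivalued map turns compact intersections into overt unions. The empty intersection
is `X`. -/
def ComputablePrebase (X : RepSpace.{u}) (Y : RepSpace.{v}) (B : Y → Opens X) : Prop :=
  ComputablePresubbase X Y B ∧
  (∃ R : SatCompacts Y → Set (Closeds Y),
    (∀ K, (R K).Nonempty) ∧
    ComputableMulti (X := satCompacts Y) (Y := closedsPos Y) R ∧
    ∀ K, ∀ A ∈ R K, ⋂ y ∈ K.1, (B y : Set X) = ⋃ y ∈ A, (B y : Set X)) ∧
  ⋃ y, (B y : Set X) = univ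

/-- `B` is a computable base of `X`: a computable prebase that is a base of the final topology. -/
def ComputableBase (X : RepSpace.{u}) (Y : RepSpace.{v}) (B : Y → Opens X) : Prop :=
  ComputablePrebase X Y B ∧ IsTopologicalBasis (range fun y => (B y : Set X))

/-- `B` is a computable Lacombe base of the computable Kolmogorov space `X`: the union map
`𝒜₊(Y) → 𝒪(X)` is computably surjective. -/
def ComputableLacombeBase (X : RepSpace.{u}) (Y : RepSpace.{v}) (B : Y → Opens X) : Prop :=
  ComputableKolmogorov X ∧
  ComputablySurjective (X := closedsPos Y) (Y := opens X)
    (fun A : Closeds Y => (⨆ y ∈ A, B y : Opens X))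

end CompTop

namespace CompTop

universe w

/-! The identity on `𝒪(X)` is the universal candidate for a base: its transpose is the neighborhood
map `𝒰`, so the Kolmogorov property says exactly that it is a presubbase. A point lies in `⋃ A` iff
`A` meets `𝒰(x)`, and in `⋂ K` iff `K ⊆ 𝒰(x)`; hence overt unions and compact intersections are
pullbacks of `∃_A` and `∀_K` along `𝒰`, computable for every `X` (`exists_pullback_nhdMap`). The
closure of `{U}` in `𝒪(X)` is computable from `U` and has union `U` (`biSup_closure_singleton`). It
inverts the union map, and applied to `⋂ K` it supplies the operator `R` of a prebase.

Conversely, a presubbase `B` is computable as a map into `𝒪(X)`, by interchanging arguments. Pulling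
`𝒰(x)` back along `B` gives `{y | x ∈ B y}`, from which `x` is recovered
(`ComputablePresubbase.kolmogorov`). The other implications are forgetful.

On names this needs only evaluation, precomposition and interchange of arguments. All three come
from the closure of computable functionals under Kleene application, together with currying. -/

theorem length_initSeg (q : Baire) (k : ℕ) : (initSeg q k).length = k := by
  simp [initSeg]

theorem initSeg_getElem? (q : Baire) (k n : ℕ) :
    (initSeg q k)[n]? = if n < k then some (q n) else none := by
  by_cases h : n < k <;> simp [initSeg, h]

theorem initSeg_succ (q : Baire) (k : ℕ) : initSeg q (k + 1) = initSeg q k ++ [q k] := by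
  simp [initSeg, List.range_succ]

/-! ### Kleene application to partially known sequences -/

/-- Evaluates `h 0, h 1, …, h (k - 1)` up to the first value other than `some 0`, which is
returned; the result is `some 0` if there is none. -/
def firstPos (h : ℕ → Option ℕ) (k : ℕ) : Option ℕ :=
  k.rec (some 0) fun i s => s.bind fun t => if t = 0 then h i else some t

theorem firstPos_zero (h : ℕ → Option ℕ) : firstPos h 0 = some 0 := rfl

theorem firstPos_succ (h : ℕ → Option ℕ) (k : ℕ) :
    firstPos h (k + 1) = (firstPos h k).bind fun t => if t = 0 then h k else some t := rfl

theorem firstPos_eq_zero {h : ℕ → Option ℕ} {k : ℕ} :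
    firstPos h k = some 0 ↔ ∀ j < k, h j = some 0 := by
  induction k with
  | zero => simp [firstPos_zero]
  | succ k ih =>
    rw [firstPos_succ, Nat.forall_lt_succ_right, ← ih]
    cases hk : firstPos h k with
    | none => simp
    | some t => by_cases ht : t = 0 <;> simp [ht]

/-- An undefined value blocks the search, so a positive result is preceded only by genuine zeros and
survives any extension of the data. -/
theorem firstPos_eq_succ {h : ℕ → Option ℕ} {k v : ℕ} :
    firstPos h k = some (v + 1) ↔
      ∃ i < k, h i = some (v + 1) ∧ ∀ j < i, h j = some 0 := by
  induction k with
  | zero => simp [firstPos_zero]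
  | succ k ih =>
    rw [firstPos_succ, Nat.exists_lt_succ_right, ← ih, ← firstPos_eq_zero (k := k)]
    cases hk : firstPos h k with
    | none => simp
    | some t => by_cases ht : t = 0 <;> simp [ht]

/-- The list of the values `some (g 0), …, some (g (k - 1))`, if all of them are defined. -/
def collect (g : ℕ → Option ℕ) (k : ℕ) : Option (List ℕ) :=
  k.rec (some []) fun i s => s.bind fun l => (g i).map fun w => l ++ [w]

theorem collect_succ (g : ℕ → Option ℕ) (k : ℕ) :
    collect g (k + 1) = (collect g k).bind fun l => (g k).map fun w => l ++ [w] := rfl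

theorem collect_eq_initSeg {g : ℕ → Option ℕ} {q : Baire} {k : ℕ}
    (h : ∀ i < k, g i = some (q i)) : collect g k = some (initSeg q k) := by
  induction k with
  | zero => rfl
  | succ k ih =>
    rw [collect_succ, ih fun i hi => h i (by omega), h k (by omega), initSeg_succ]
    rfl

theorem collect_mono {g g' : ℕ → Option ℕ} (h : ∀ i w, g i = some w → g' i = some w)
    {k : ℕ} {l : List ℕ} (hl : collect g k = some l) : collect g' k = some l := by
  induction k generalizing l with
  | zero => exact hl
  | succ k ih =>
    rw [collect_succ, Option.bind_eq_some_iff] at hl ⊢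
    obtain ⟨l', hl', hm⟩ := hl
    obtain ⟨w, hw, hlw⟩ := Option.map_eq_some_iff.1 hm
    exact ⟨l', ih hl', Option.map_eq_some_iff.2 ⟨w, h _ _ hw, hlw⟩⟩

/-- The answer of the partially known associate `f` to the query `n` and the initial segment of
length `k` of the partially known sequence `g`. -/
def answer (f g : ℕ → Option ℕ) (n k : ℕ) : Option ℕ :=
  (collect g k).bind fun l => f (Encodable.encode (n, l))

theorem answer_mono {f f' g g' : ℕ → Option ℕ} (hf : ∀ i w, f i = some w → f' i = some w)
    (hg : ∀ i w, g i = some w → g' i = some w) {n k v : ℕ} (h : answer f g n k = some v) :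
    answer f' g' n k = some v := by
  obtain ⟨l, hl, hv⟩ := Option.bind_eq_some_iff.1 h
  exact Option.bind_eq_some_iff.2 ⟨l, collect_mono hg hl, hf _ _ hv⟩

/-- The `n`-th value of the application of the partially known associate `f` to the partially
known sequence `g`, computed from the first `K` queries. -/
def applyApprox (f g : ℕ → Option ℕ) (K n : ℕ) : Option ℕ :=
  (firstPos (answer f g n) K).bind fun t => if t = 0 then none else some (t - 1)

theorem applyApprox_eq_some {f g : ℕ → Option ℕ} {K n v : ℕ} :
    applyApprox f g K n = some v ↔
      ∃ i < K, answer f g n i = some (v + 1) ∧ ∀ j < i, answer f g n j = some 0 := by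
  rw [← firstPos_eq_succ, applyApprox]
  cases firstPos (answer f g n) K with
  | none => simp
  | some t => cases t <;> simp

/-- A value rests on finitely many defined answers, and the first positive one is already
determined; more information or a larger bound cannot displace it. -/
theorem applyApprox_mono {f f' g g' : ℕ → Option ℕ} (hf : ∀ i w, f i = some w → f' i = some w)
    (hg : ∀ i w, g i = some w → g' i = some w) {K K' n v : ℕ} (hK : K ≤ K')
    (h : applyApprox f g K n = some v) : applyApprox f' g' K' n = some v := by
  obtain ⟨i, hi, hv, h0⟩ := applyApprox_eq_some.1 h
  exact applyApprox_eq_some.2 ⟨i, by omega, answer_mono hf hg hv, fun j hj =>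
    answer_mono hf hg (h0 j hj)⟩

/-! ### Computability of the approximations -/

section Computability

variable {α : Type*} [Primcodable α]

theorem computable_ite_eq_zero {σ : Type*} [Primcodable σ] {t : α → ℕ} {f g : α → σ}
    (ht : Computable t) (hf : Computable f) (hg : Computable g) :
    Computable fun a => if t a = 0 then f a else g a := by
  refine (Computable.nat_casesOn ht hf (Computable.to₂ (hg.comp Computable.fst))).of_eq fun a => ?_
  cases t a <;> rfl

theorem computable_collect {g : α → ℕ → Option ℕ} (hg : Computable₂ g) {k : α → ℕ}
    (hk : Computable k) : Computable fun a => collect (g a) (k a) := by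
  refine Computable.nat_rec (h := fun a (x : ℕ × Option (List ℕ)) =>
    x.2.bind fun l => (g a x.1).map fun w => l ++ [w]) hk (Computable.const _) ?_
  refine Computable.option_bind (Computable.snd.comp Computable.snd) ?_
  refine Computable.option_map (hg.comp (Computable.fst.comp Computable.fst)
    (Computable.fst.comp (Computable.snd.comp Computable.fst))) ?_
  exact Computable.list_concat.comp (Computable.snd.comp Computable.fst) Computable.snd

theorem computable_firstPos {h : α → ℕ → Option ℕ} (hh : Computable₂ h) {k : α → ℕ}
    (hk : Computable k) : Computable fun a => firstPos (h a) (k a) := by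
  refine Computable.nat_rec (h := fun a (x : ℕ × Option ℕ) =>
    x.2.bind fun t => if t = 0 then h a x.1 else some t) hk (Computable.const _) ?_
  refine Computable.option_bind (Computable.snd.comp Computable.snd) ?_
  exact computable_ite_eq_zero Computable.snd (hh.comp (Computable.fst.comp Computable.fst)
    (Computable.fst.comp (Computable.snd.comp Computable.fst)))
    (Computable.option_some.comp Computable.snd)

theorem computable_applyApprox {f g : α → ℕ → Option ℕ} (hf : Computable₂ f)
    (hg : Computable₂ g) {K n : α → ℕ} (hK : Computable K) (hn : Computable n) :
    Computable fun a => applyApprox (f a) (g a) (K a) (n a) := by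
  have hans : Computable₂ fun (a : α) (k : ℕ) => answer (f a) (g a) (n a) k := by
    refine Computable.option_bind (computable_collect
      (g := fun (x : α × ℕ) => g x.1) (hg.comp (Computable.fst.comp Computable.fst)
        Computable.snd) Computable.snd) ?_
    exact hf.comp (Computable.fst.comp Computable.fst) (Computable.encode.comp
      (Computable.pair (hn.comp (Computable.fst.comp Computable.fst)) Computable.snd))
  refine Computable.option_bind (computable_firstPos hans hK) ?_
  exact computable_ite_eq_zero Computable.snd (Computable.const none)
    (Computable.option_some.comp (Computable.pred.comp Computable.snd))

end Computability

/-! ### Computable functionals of two arguments -/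

/-- `φ` computes the values of the partial functional `Φ` from initial segments of its arguments,
and does not revise a value on longer initial segments. -/
structure Approximates (φ : List ℕ → List ℕ → ℕ → Option ℕ) (Φ : Baire → Baire →. Baire) :
    Prop where
  mono : ∀ p q n k k' v, k ≤ k' → φ (initSeg p k) (initSeg q k) n = some v →
    φ (initSeg p k') (initSeg q k') n = some v
  converges : ∀ p q r, r ∈ Φ p q → ∀ n, ∃ k, φ (initSeg p k) (initSeg q k) n = some (r n)

/-- A partial functional of two arguments is computable if it has a computable approximation. -/
def ComputableFunctional (Φ : Baire → Baire →. Baire) : Prop :=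
  ∃ φ : List ℕ → List ℕ → ℕ → Option ℕ,
    Computable (fun x : (List ℕ × List ℕ) × ℕ => φ x.1.1 x.1.2 x.2) ∧ Approximates φ Φ

/-- Soundness follows from the two axioms: any value found and the correct one persist to a common
later stage, where they must agree. -/
theorem Approximates.eq_of_mem {φ : List ℕ → List ℕ → ℕ → Option ℕ} {Φ : Baire → Baire →. Baire}
    (h : Approximates φ Φ) {p q r : Baire} (hr : r ∈ Φ p q) {n k v : ℕ}
    (hv : φ (initSeg p k) (initSeg q k) n = some v) : v = r n := by
  obtain ⟨k', hk'⟩ := h.converges p q r hr n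
  have h1 := h.mono p q n _ _ _ (le_max_left k k') hv
  have h2 := h.mono p q n _ _ _ (le_max_right k k') hk'
  exact Option.some_injective _ (h1.symm.trans h2)

/-- Finitely many values of a functional are approximated simultaneously. -/
theorem Approximates.converges_below {φ : List ℕ → List ℕ → ℕ → Option ℕ}
    {Φ : Baire → Baire →. Baire} (h : Approximates φ Φ) {p q r : Baire} (hr : r ∈ Φ p q) (N : ℕ) :
    ∃ K, ∀ k, K ≤ k → ∀ n < N, φ (initSeg p k) (initSeg q k) n = some (r n) := by
  choose K hK using h.converges p q r hr
  refine ⟨(Finset.range N).sup K, fun k hk n hn => h.mono p q n _ _ _ ?_ (hK n)⟩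
  exact (Finset.le_sup (f := K) (Finset.mem_range.2 hn)).trans hk

theorem ComputableFunctional.of_le {Φ Ψ : Baire → Baire →. Baire} (h : ComputableFunctional Ψ)
    (hle : ∀ p q r, r ∈ Φ p q → r ∈ Ψ p q) : ComputableFunctional Φ := by
  obtain ⟨φ, hφ, ha⟩ := h
  exact ⟨φ, hφ, ha.mono, fun p q r hr => ha.converges p q r (hle p q r hr)⟩

theorem computableFunctional_fst : ComputableFunctional fun p _ => Part.some p := by
  refine ⟨fun l _ n => l[n]?, Computable.list_getElem?.comp
    (Computable.fst.comp Computable.fst) Computable.snd, ?_, ?_⟩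
  · intro p q n k k' v hk
    simp only [initSeg_getElem?, Option.ite_none_right_eq_some]
    exact fun ⟨h, hv⟩ => ⟨by omega, hv⟩
  · intro p q r hr n
    obtain rfl := Part.mem_some_iff.1 hr
    exact ⟨n + 1, by simp [initSeg_getElem?]⟩

theorem computableFunctional_snd : ComputableFunctional fun _ q => Part.some q := by
  refine ⟨fun _ l n => l[n]?, Computable.list_getElem?.comp
    (Computable.snd.comp Computable.fst) Computable.snd, ?_, ?_⟩
  · intro p q n k k' v hk
    simp only [initSeg_getElem?, Option.ite_none_right_eq_some]
    exact fun ⟨h, hv⟩ => ⟨by omega, hv⟩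
  · intro p q r hr n
    obtain rfl := Part.mem_some_iff.1 hr
    exact ⟨n + 1, by simp [initSeg_getElem?]⟩

theorem computableFunctional_const {a : Baire} (ha : Computable a) :
    ComputableFunctional fun _ _ => Part.some a := by
  refine ⟨fun _ _ n => some (a n), Computable.option_some.comp (ha.comp Computable.snd),
    fun _ _ _ _ _ _ _ h => h, fun p q r hr n => ?_⟩
  obtain rfl := Part.mem_some_iff.1 hr
  exact ⟨0, rfl⟩

/-- Computable functionals are closed under Kleene application. -/
theorem ComputableFunctional.app {Φ Ψ : Baire → Baire →. Baire} (hΦ : ComputableFunctional Φ)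
    (hΨ : ComputableFunctional Ψ) :
    ComputableFunctional fun p q => (Φ p q).bind fun f => (Ψ p q).bind (kleeneApp f) := by
  obtain ⟨φ, hφ, ha⟩ := hΦ
  obtain ⟨ψ, hψ, hb⟩ := hΨ
  -- The length of the known segment also bounds the search, so the bound grows with the input.
  refine ⟨fun l m n => applyApprox (φ l m) (ψ l m) l.length n, ?_, ?_, ?_⟩
  · refine computable_applyApprox (α := (List ℕ × List ℕ) × ℕ)
      (f := fun x => φ x.1.1 x.1.2) (g := fun x => ψ x.1.1 x.1.2)
      (hφ.comp (Computable.pair (Computable.fst.comp Computable.fst) Computable.snd))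
      (hψ.comp (Computable.pair (Computable.fst.comp Computable.fst) Computable.snd))
      (Computable.list_length.comp (Computable.fst.comp Computable.fst)) Computable.snd
  · intro p q n k k' v hk
    exact applyApprox_mono (fun i w => ha.mono p q i k k' w hk) (fun i w => hb.mono p q i k k' w hk)
      (by simpa [length_initSeg] using hk)
  · intro p q r hr n
    obtain ⟨f, hf, hr⟩ := Part.mem_bind_iff.1 hr
    obtain ⟨g, hg, hr⟩ := Part.mem_bind_iff.1 hr
    obtain ⟨i, hi, h0⟩ := mem_kleeneApp.1 hr n
    -- The value uses only the queries `0, …, i`: these involve the first `i` entries of `g`, and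
    -- the entries of `f` up to the largest query code.
    obtain ⟨K, hK⟩ := hb.converges_below hg i
    obtain ⟨M, hM⟩ := ha.converges_below hf
      ((Finset.range (i + 1)).sup (fun j => query n g j) + 1)
    let k := max (i + 1) (max K M)
    have hans : ∀ j ≤ i, answer (φ (initSeg p k) (initSeg q k)) (ψ (initSeg p k) (initSeg q k)) n j
        = some (f (query n g j)) := by
      intro j hj
      have hc := collect_eq_initSeg (k := j) fun i' hi' => hK k (by omega) i' (by omega)
      have hle : query n g j ≤ (Finset.range (i + 1)).sup (fun j => query n g j) :=
        Finset.le_sup (f := fun j => query n g j) (Finset.mem_range.2 (by omega))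
      rw [answer, hc]
      exact hM k (by omega) _ (Nat.lt_succ_of_le hle)
    refine ⟨k, applyApprox_eq_some.2 ⟨i, ?_, ?_, fun j hj => ?_⟩⟩
    · rw [length_initSeg]
      omega
    · rw [hans i le_rfl, hi]
    · rw [hans j hj.le, h0 j hj]

/-- Applying `F` is Kleene application of a fixed computable associate, up to restriction of the
domain. -/
theorem BaireComputable.computableFunctional_comp {F : Baire →. Baire} (hF : BaireComputable F)
    {Φ : Baire → Baire →. Baire} (hΦ : ComputableFunctional Φ) :
    ComputableFunctional fun p q => (Φ p q).bind F := by
  obtain ⟨a, ha, h⟩ := hF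
  refine ((computableFunctional_const ha).app hΦ).of_le fun p q r hr => ?_
  obtain ⟨s, hs, hr⟩ := Part.mem_bind_iff.1 hr
  exact Part.mem_bind (Part.mem_some a) (Part.mem_bind hs (h s r hr))

/-! ### From functionals to associates -/

/-- If the answers of `a` on input `q` agree with `r` and are eventually defined, then `r` is the
value of the function with associate `a` at `q`. -/
theorem mem_kleeneApp_of_approx {a q r : Baire} {h : ℕ → ℕ → Option ℕ}
    (ha : ∀ n k, a (query n q k) = (h n k).elim 0 Nat.succ)
    (hval : ∀ n k v, h n k = some v → v = r n) (hconv : ∀ n, ∃ k, h n k ≠ none) :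
    r ∈ kleeneApp a q := by
  classical
  refine mem_kleeneApp.2 fun n => ⟨Nat.find (hconv n), ?_, fun j hj => ?_⟩
  · obtain ⟨v, hv⟩ := Option.ne_none_iff_exists'.1 (Nat.find_spec (hconv n))
    rw [ha, hv, ← hval _ _ _ hv]
    rfl
  · rw [ha, not_not.1 (Nat.find_min (hconv n) hj)]
    rfl

theorem computable_elim_succ {α : Type*} [Primcodable α] {f : α → Option ℕ} (hf : Computable f) :
    Computable fun a => (f a).elim 0 Nat.succ := by
  refine (Computable.option_casesOn hf (Computable.const 0)
    (Computable.to₂ (Computable.succ.comp Computable.snd))).of_eq fun a => ?_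
  cases f a <;> rfl

/-- The diagonal of a computable functional is computable. -/
theorem ComputableFunctional.diag {Φ : Baire → Baire →. Baire} (hΦ : ComputableFunctional Φ) :
    BaireComputable fun p => Φ p p := by
  obtain ⟨φ, hφ, ha⟩ := hΦ
  -- The associate runs `φ` on the queried segment; the answer `0` means "not yet known", so values
  -- are shifted by one.
  refine ⟨fun c => ((Encodable.decode c : Option (ℕ × List ℕ)).bind
    fun x => φ x.2 x.2 x.1).elim 0 Nat.succ, ?_, fun p r hr => ?_⟩
  · refine computable_elim_succ (Computable.option_bind Computable.decode ?_)
    exact hφ.comp (Computable.pair (Computable.pair (Computable.snd.comp Computable.snd)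
      (Computable.snd.comp Computable.snd)) (Computable.fst.comp Computable.snd))
  · refine mem_kleeneApp_of_approx (h := fun n k => φ (initSeg p k) (initSeg p k) n)
      (fun n k => ?_) (fun n k v hv => ha.eq_of_mem hr hv) fun n => ?_
    · simp [query]
    · obtain ⟨k, hk⟩ := ha.converges p p r hr n
      exact ⟨k, by simp [hk]⟩

/-- Currying: an associate of `Φ p` can be computed from `p`. -/
theorem ComputableFunctional.curry {Φ : Baire → Baire →. Baire} (hΦ : ComputableFunctional Φ) :
    ∃ F : Baire → Baire, BaireComputable (F : Baire →. Baire) ∧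
      ∀ p q r, r ∈ Φ p q → r ∈ kleeneApp (F p) q := by
  obtain ⟨φ, hφ, ha⟩ := hΦ
  let val : List ℕ → ℕ → ℕ := fun l c =>
    ((Encodable.decode c : Option (ℕ × List ℕ)).bind fun x => φ l x.2 x.1).elim 0 Nat.succ
  -- A query about a segment of `q` of length `len c` is answered from the equally long segment of
  -- `p`. Thus each entry of the curried associate needs only finitely many entries of `p`.
  let len : ℕ → ℕ := fun c =>
    ((Encodable.decode c : Option (ℕ × List ℕ)).map fun x => x.2.length).getD 0
  -- Truncated subtraction tests `len c ≤ l.length`: the associate of the currying map waits for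
  -- enough of `p`, and first answers at length exactly `len c`.
  let reply : ℕ → List ℕ → Option ℕ := fun c l =>
    if len c - l.length = 0 then some (val l c) else none
  have hval : Computable₂ val := by
    refine computable_elim_succ (Computable.option_bind (Computable.decode.comp Computable.snd) ?_)
    exact hφ.comp (Computable.pair (Computable.pair (Computable.fst.comp Computable.fst)
      (Computable.snd.comp Computable.snd)) (Computable.fst.comp Computable.snd))
  have hlen : Computable len := Computable.option_getD (Computable.option_map Computable.decode
    (Computable.list_length.comp (Computable.snd.comp Computable.snd))) (Computable.const 0)
  have hreply : Computable₂ reply := computable_ite_eq_zero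
    ((Primrec.nat_sub.to_comp).comp (hlen.comp Computable.fst)
      (Computable.list_length.comp Computable.snd))
    (Computable.option_some.comp (hval.comp Computable.snd Computable.fst)) (Computable.const none)
  refine ⟨fun p c => val (initSeg p (len c)) c, ⟨fun c =>
    ((Encodable.decode c : Option (ℕ × List ℕ)).bind fun x => reply x.1 x.2).elim 0 Nat.succ,
    ?_, fun p r hr => ?_⟩, fun p q r hr => ?_⟩
  · refine computable_elim_succ (Computable.option_bind Computable.decode ?_)
    exact hreply.comp (Computable.fst.comp Computable.snd) (Computable.snd.comp Computable.snd)
  · obtain rfl := Part.mem_some_iff.1 hr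
    refine mem_kleeneApp.2 fun c => ⟨len c, ?_, fun j hj => ?_⟩
    · simp [query, reply, length_initSeg]
    · have : len c - j ≠ 0 := by omega
      simp [query, reply, length_initSeg, this]
  · refine mem_kleeneApp_of_approx (h := fun n k => φ (initSeg p k) (initSeg q k) n)
      (fun n k => ?_) (fun n k v hv => ha.eq_of_mem hr hv) fun n => ?_
    · have : len (query n q k) = k := by simp [len, query, length_initSeg]
      simp only [this]
      simp [val, query]
    · obtain ⟨k, hk⟩ := ha.converges p q r hr n
      exact ⟨k, by simp [hk]⟩

/-- Regard `F` as a functional that ignores its second argument, apply `G`, and take the diagonal.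
-/
theorem BaireComputable.comp {F G : Baire →. Baire} (hG : BaireComputable G)
    (hF : BaireComputable F) : BaireComputable fun p => (F p).bind G :=
  (hG.computableFunctional_comp (((hF.computableFunctional_comp
    computableFunctional_fst).of_le (Φ := fun p _ => F p) fun p _ _ hr =>
      Part.mem_bind (Part.mem_some p) hr))).diag

/-! ### Evaluation, precomposition and interchange of arguments -/

/-- An associate of the evaluation `q ↦ q · p` can be computed from `p`. -/
theorem exists_evaluator :
    ∃ N : Baire → Baire, BaireComputable (N : Baire →. Baire) ∧
      ∀ p q r, r ∈ kleeneApp q p → r ∈ kleeneApp (N p) q := by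
  obtain ⟨N, hN, h⟩ := (computableFunctional_snd.app computableFunctional_fst).curry
  exact ⟨N, hN, fun p q r hr => h p q r
    (Part.mem_bind (Part.mem_some q) (Part.mem_bind (Part.mem_some p) hr))⟩

/-- Precomposition of an associate with a computable function is computable. -/
theorem BaireComputable.exists_precomp {F : Baire → Baire}
    (hF : BaireComputable (F : Baire →. Baire)) :
    ∃ J : Baire → Baire, BaireComputable (J : Baire →. Baire) ∧
      ∀ a p r, r ∈ kleeneApp a (F p) → r ∈ kleeneApp (J a) p := by
  obtain ⟨J, hJ, h⟩ := (computableFunctional_fst.app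
    (hF.computableFunctional_comp computableFunctional_snd)).curry
  exact ⟨J, hJ, fun p q r hr => h p q r (Part.mem_bind (Part.mem_some p)
    (Part.mem_bind (Part.mem_bind (Part.mem_some q) (Part.mem_some _)) hr))⟩

/-- The arguments of a computable family of associates can be interchanged. -/
theorem BaireComputable.exists_flip {F : Baire →. Baire} (hF : BaireComputable F) :
    ∃ T : Baire → Baire, BaireComputable (T : Baire →. Baire) ∧
      ∀ p q s r, s ∈ F q → r ∈ kleeneApp s p → r ∈ kleeneApp (T p) q := by
  obtain ⟨T, hT, h⟩ := ((hF.computableFunctional_comp computableFunctional_snd).app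
    computableFunctional_fst).curry
  refine ⟨T, hT, fun p q s r hs hr => h p q r ?_⟩
  exact Part.mem_bind (Part.mem_bind (Part.mem_some q) hs) (Part.mem_bind (Part.mem_some p) hr)

/-! ### Computable maps and names of characteristic functions -/

theorem computableMap_iff {X : RepSpace.{u}} {Y : RepSpace.{v}} {f : X → Y} :
    ComputableMap f ↔ ∃ F : Baire →. Baire, BaireComputable F ∧
      ∀ p, ∀ x ∈ X.rep p, ∃ r ∈ F p, f x ∈ Y.rep r := by
  constructor
  · rintro ⟨F, hF, h⟩
    refine ⟨F, hF, fun p x hx => ?_⟩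
    obtain ⟨r, hr, y, hy, rfl⟩ := h p x hx ⟨_, rfl⟩
    exact ⟨r, hr, hy⟩
  · rintro ⟨F, hF, h⟩
    refine ⟨F, hF, fun p x hx _ => ?_⟩
    obtain ⟨r, hr, hy⟩ := h p x hx
    exact ⟨r, hr, _, hy, rfl⟩

/-- A map with a total computable function on names as its realizer is computable. -/
theorem ComputableMap.of_total {X : RepSpace.{u}} {Y : RepSpace.{v}} {f : X → Y}
    {F : Baire → Baire} (hF : BaireComputable (F : Baire →. Baire))
    (h : ∀ p, ∀ x ∈ X.rep p, f x ∈ Y.rep (F p)) : ComputableMap f :=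
  computableMap_iff.2 ⟨F, hF, fun p x hx => ⟨F p, Part.mem_some _, h p x hx⟩⟩

/-- A computable selector of a multivalued map makes it computable. -/
theorem ComputableMap.computableMulti {X : RepSpace.{u}} {Y : RepSpace.{v}} {f : X → Y}
    (hf : ComputableMap f) {R : X → Set Y} (h : ∀ x, f x ∈ R x) : ComputableMulti R := by
  obtain ⟨F, hF, hf⟩ := computableMap_iff.1 hf
  refine ⟨F, hF, fun p x hx _ => ?_⟩
  obtain ⟨r, hr, hy⟩ := hf p x hx
  exact ⟨r, hr, _, hy, h x⟩

theorem ComputableMap.comp {X : RepSpace.{u}} {Y : RepSpace.{v}} {Z : RepSpace.{w}} {g : Y → Z}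
    {f : X → Y} (hg : ComputableMap g) (hf : ComputableMap f) : ComputableMap (g ∘ f) := by
  obtain ⟨F, hF, hf⟩ := computableMap_iff.1 hf
  obtain ⟨G, hG, hg⟩ := computableMap_iff.1 hg
  refine computableMap_iff.2 ⟨_, hG.comp hF, fun p x hx => ?_⟩
  obtain ⟨r, hr, hy⟩ := hf p x hx
  obtain ⟨s, hs, hz⟩ := hg r _ hy
  exact ⟨s, Part.mem_bind hr hs, hz⟩

/-- Pullback along a map `c` realized by `F`: it suffices that `s` acts on `q` as `p` acts on `F q`.
-/
theorem NamesChar.of_forall_mem {X : RepSpace.{u}} {Y : RepSpace.{v}} {p s : Baire} {f : X → Prop}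
    {g : Y → Prop} (hp : NamesChar p f) {c : Y → X} {F : Baire → Baire}
    (hc : ∀ q, ∀ y ∈ Y.rep q, c y ∈ X.rep (F q)) (hg : ∀ y, f (c y) ↔ g y)
    (h : ∀ q r, r ∈ kleeneApp p (F q) → r ∈ kleeneApp s q) : NamesChar s g := by
  refine namesChar_iff.2 fun q y hy => ?_
  obtain ⟨r, hr, hf⟩ := namesChar_iff.1 hp _ _ (hc q y hy)
  exact ⟨r, h q r hr, hf.trans (hg y)⟩

/-- A positive answer is given after reading a finite part of the input. Openness of a set can
therefore be proved by exhibiting a name. -/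
theorem NamesChar.isOpen {X : RepSpace.{u}} {p : Baire} {f : X → Prop} (hp : NamesChar p f) :
    IsOpen {x | f x} := by
  refine isOpen_iff.2 fun q x hx hf => ?_
  obtain ⟨M, hM⟩ := namesChar_locally hp hx hf
  exact ⟨M, fun q' hq' x' hx' => hM p (fun _ _ => rfl) f hp q' hq' x' hx'⟩

theorem mem_satCompacts_rep {Y : RepSpace.{u}} {p : Baire} {K : SatCompacts Y} :
    K ∈ (satCompacts Y).rep p ↔ NamesChar p (forallOn K.1) :=
  mem_partialOfRel namesSatCompact_unique

theorem mem_closedsPos_rep {Y : RepSpace.{u}} {p : Baire} {A : Closeds Y} :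
    A ∈ (closedsPos Y).rep p ↔ NamesChar p (existsOn (A : Set Y)) :=
  mem_partialOfRel namesClosed_unique

/-! ### The neighborhood map -/

/-- If `q ↦ q · p` has associate `N p`, then `N` maps names of points to names of their
neighborhood filters. -/
theorem namesChar_evaluator {X : RepSpace.{u}} {N : Baire → Baire}
    (hN : ∀ p q r, r ∈ kleeneApp q p → r ∈ kleeneApp (N p) q) {p : Baire} {x : X}
    (hx : x ∈ X.rep p) : NamesChar (N p) (fun U : opens X => x ∈ asOpens U) := by
  refine namesChar_iff.2 fun q U hU => ?_
  obtain ⟨r, hr, hf⟩ := namesChar_iff.1 (mem_opens_rep.1 hU) p x hx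
  exact ⟨r, hN p q r hr, hf⟩

theorem nhdMap_computable (X : RepSpace.{u}) : ComputableMap (nhdMap X) := by
  obtain ⟨N, hN, h⟩ := exists_evaluator
  exact ComputableMap.of_total hN fun p x hx => mem_opens_rep.2 (namesChar_evaluator h hx)

/-- Families of characteristic functions on `𝒪𝒪(X)` can be pulled back along the neighborhood map
computably. -/
theorem exists_pullback_nhdMap (X : RepSpace.{u}) :
    ∃ J : Baire → Baire, BaireComputable (J : Baire →. Baire) ∧
      ∀ a (w : opens (opens X) → Prop), NamesChar a w → NamesChar (J a) fun x => w (nhdMap X x) := by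
  obtain ⟨N, hN, h⟩ := exists_evaluator
  obtain ⟨J, hJ, h'⟩ := hN.exists_precomp
  exact ⟨J, hJ, fun a w ha => ha.of_forall_mem (c := nhdMap X)
    (fun q x hx => mem_opens_rep.2 (namesChar_evaluator h hx)) (fun _ => Iff.rfl) (h' a)⟩

/-! ### Overt unions and compact intersections of open sets -/

/-- An open set meeting the closure of `{y}` meets `{y}`. Hence a name of this closure is the same
thing as a name of the neighborhood filter of `y`. -/
theorem existsOn_closure_singleton {Y : RepSpace.{u}} (y : Y) (U : opens Y) :
    existsOn (Closeds.closure {y} : Set Y) U ↔ y ∈ asOpens U := by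
  constructor
  · rintro ⟨z, hz, hzU⟩
    obtain ⟨w, hwU, rfl⟩ := mem_closure_iff.1 hz _ (asOpens U).isOpen hzU
    exact hwU
  · exact fun h => ⟨y, subset_closure rfl, h⟩

/-- The map `y ↦ closure {y}` into the closed sets with positive information is computable. -/
theorem closure_singleton_computable (Y : RepSpace.{u}) :
    ComputableMap (X := Y) (Y := closedsPos Y) fun y => (Closeds.closure {y} : Closeds Y) := by
  obtain ⟨N, hN, h⟩ := exists_evaluator
  refine ComputableMap.of_total hN fun p y hy => mem_closedsPos_rep.2 ?_
  have : existsOn ((Closeds.closure {y} : Closeds Y) : Set Y) = fun U => y ∈ asOpens U :=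
    funext fun U => propext (existsOn_closure_singleton y U)
  rw [this]
  exact namesChar_evaluator h hy

/-- The open sets in the closure of `{U}` are subsets of `U`. -/
theorem biSup_closure_singleton {X : RepSpace.{u}} (U : opens X) :
    (⨆ V ∈ (Closeds.closure {U} : Closeds (opens X)), asOpens V) = asOpens U := by
  refine le_antisymm (iSup₂_le fun V hV x hx => ?_)
    (le_iSup₂_of_le (f := fun V (_ : V ∈ (Closeds.closure {U} : Closeds (opens X))) => asOpens V)
      U (subset_closure rfl) le_rfl)
  -- The filter `nhdMap X x` is open in `𝒪(X)` and contains `V`, a point of the closure of `{U}`; so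
  -- it contains `U`.
  exact (existsOn_closure_singleton U (nhdMap X x)).1 ⟨V, hV, hx⟩

/-- A point lies in the union iff `A` meets its neighborhood filter, so a name of `∃_A` is pulled
back along `nhdMap`. -/
theorem biSup_computable (X : RepSpace.{u}) :
    ComputableMap (X := closedsPos (opens X)) (Y := opens X)
      fun A : Closeds (opens X) => (⨆ U ∈ A, asOpens U : Opens X) := by
  obtain ⟨J, hJ, h⟩ := exists_pullback_nhdMap X
  refine ComputableMap.of_total hJ fun p A hA => mem_opens_rep.2 ?_
  have : (fun x : X => x ∈ (⨆ U ∈ (show Closeds (opens X) from A), asOpens U : Opens X)) =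
      fun x => existsOn ((show Closeds (opens X) from A) : Set (opens X)) (nhdMap X x) := by
    funext x
    simp only [Opens.mem_iSup, exists_prop]
    rfl
  rw [this]
  exact h p _ (mem_closedsPos_rep.1 hA)

/-- Membership of `x` means `K ⊆ 𝒰(x)`, so a name of `∀_K` pulls back to a name of the intersection.
-/
theorem isOpen_biInter_compact {X : RepSpace.{u}} (K : SatCompacts (opens X)) :
    IsOpen {x : X | ∀ U ∈ K.1, x ∈ asOpens U} := by
  obtain ⟨J, -, h⟩ := exists_pullback_nhdMap X
  obtain ⟨p, hp⟩ := (satCompacts (opens X)).surj K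
  exact (h p _ (mem_satCompacts_rep.1 hp)).isOpen

/-- The intersection of a compact family of open sets, as an open set. -/
def compactInter {X : RepSpace.{u}} (K : SatCompacts (opens X)) : Opens X :=
  ⟨{x : X | ∀ U ∈ K.1, x ∈ asOpens U}, isOpen_biInter_compact K⟩

theorem compactInter_computable (X : RepSpace.{u}) :
    ComputableMap (X := satCompacts (opens X)) (Y := opens X) compactInter := by
  obtain ⟨J, hJ, h⟩ := exists_pullback_nhdMap X
  exact ComputableMap.of_total hJ fun p K hK => mem_opens_rep.2 (h p _ (mem_satCompacts_rep.1 hK))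

/-! ### The implications between the notions of base -/

/-- The map `U ↦ closure {U}` is a computable section of the union map. -/
theorem ComputableKolmogorov.lacombeBase {X : RepSpace.{u}} (hX : ComputableKolmogorov X) :
    ComputableLacombeBase X (opens X) (fun U : Opens X => U) := by
  refine ⟨hX, fun U => ⟨(Closeds.closure {U} : Closeds (opens X)), biSup_closure_singleton U⟩,
    biSup_computable X, ?_⟩
  exact (closure_singleton_computable (opens X)).computableMulti fun U => biSup_closure_singleton U

theorem ComputableKolmogorov.base {X : RepSpace.{u}} (hX : ComputableKolmogorov X) :
    ComputableBase X (opens X) (fun U : Opens X => U) := by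
  -- The transpose of the identity is `nhdMap X`, so `hX` is literally the presubbase condition.
  refine ⟨⟨⟨fun x => (nhdMap X x).isOpen, hX⟩,
    -- The compact intersection is itself a member of the base, so the closure of its singleton
    -- serves as the overt index set.
    ⟨fun K => {(Closeds.closure {compactInter K} : Closeds (opens X))}, fun K => ⟨_, rfl⟩,
      (closure_singleton_computable (opens X)).comp (compactInter_computable X), ?_⟩, ?_⟩, ?_⟩
  · rintro K A rfl
    have h := congrArg (fun V : Opens X => (V : Set X)) (biSup_closure_singleton (compactInter K))
    simp only [Opens.coe_iSup] at h
    refine Eq.trans ?_ h.symm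
    ext x
    exact mem_iInter₂
  · exact eq_univ_of_forall fun x => mem_iUnion.2 ⟨(⊤ : Opens X), trivial⟩
  · convert isTopologicalBasis_opens (α := X) using 1
    ext U
    exact ⟨fun ⟨V, hV⟩ => hV ▸ V.isOpen, fun hU => ⟨⟨U, hU⟩, rfl⟩⟩

/-- The set `{y | x ∈ B y}` is the preimage of the neighborhood filter of `x` under `B`, so that
filter determines `x` computably through the inverse of the transpose. -/
theorem ComputablePresubbase.kolmogorov {X : RepSpace.{u}} {Y : RepSpace.{v}} {B : Y → Opens X}
    (hB : ComputablePresubbase X Y B) : ComputableKolmogorov X := by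
  obtain ⟨ho, hinj, hcomp, hinv⟩ := hB
  have key : ∀ {x x' : X}, nhdMap X x = nhdMap X x' → ∀ y, x ∈ B y → x' ∈ B y := by
    intro x x' h y hy
    have hm : (B y : opens X) ∈ asOpens (nhdMap X x) := hy
    rw [h] at hm
    exact hm
  refine ⟨fun x x' h => hinj ?_, nhdMap_computable X, ?_⟩
  · exact Opens.ext (Set.ext fun y => ⟨key h y, key h.symm y⟩)
  obtain ⟨F, hF, hFt⟩ := computableMap_iff.1 hcomp
  obtain ⟨G, hG, hGi⟩ := hinv
  -- Interchanging the arguments of a realizer of the transpose gives a realizer `T` of `B`; `J` is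
  -- precomposition with `T`.
  obtain ⟨T, hT, hTB⟩ := hF.exists_flip
  obtain ⟨J, hJ, hJT⟩ := hT.exists_precomp
  have hBT : ∀ q, ∀ y ∈ Y.rep q, (B y : opens X) ∈ (opens X).rep (T q) := by
    refine fun q y hy => mem_opens_rep.2 (namesChar_iff.2 fun p x hx => ?_)
    obtain ⟨s, hs, hxs⟩ := hFt p x hx
    obtain ⟨r, hr, hf⟩ := namesChar_iff.1 (mem_opens_rep.1 hxs) q y hy
    exact ⟨r, hTB q p s r hs hr, hf⟩
  refine ⟨_, hG.comp hJ, ?_⟩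
  rintro p _ hp ⟨x, rfl⟩
  have hname : (⟨{y : Y | x ∈ B y}, ho x⟩ : Opens Y) ∈ (opens Y).rep (J p) :=
    mem_opens_rep.2 ((mem_opens_rep.1 hp).of_forall_mem (c := B) hBT (fun _ => Iff.rfl) (hJT p))
  obtain ⟨r, hr, x', hx', he⟩ := hGi _ _ hname ⟨x, rfl⟩
  -- The inverse only yields some `x'` with the same transpose as `x`; injectivity identifies the
  -- two.
  exact ⟨r, Part.mem_bind (Part.mem_some _) hr, x', hx', congrArg (nhdMap X) (hinj he)⟩

end CompTop

theorem theorem23 (X : CompTop.RepSpace.{u}) :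
    List.TFAE [
      CompTop.ComputableKolmogorov X,
      ∃ (Y : CompTop.RepSpace.{u}) (B : Y → TopologicalSpace.Opens X),
        CompTop.ComputablePresubbase X Y B,
      ∃ (Y : CompTop.RepSpace.{u}) (B : Y → TopologicalSpace.Opens X),
        CompTop.ComputablePrebase X Y B,
      ∃ (Y : CompTop.RepSpace.{u}) (B : Y → TopologicalSpace.Opens X),
        CompTop.ComputableBase X Y B,
      ∃ (Y : CompTop.RepSpace.{u}) (B : Y → TopologicalSpace.Opens X),
        CompTop.ComputableLacombeBase X Y B,
      CompTop.ComputableLacombeBase X (CompTop.opens X)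
        (fun U : TopologicalSpace.Opens X => U)] := by
  tfae_have 1 → 6 := fun h => h.lacombeBase
  tfae_have 6 → 5 := fun h => ⟨_, _, h⟩
  tfae_have 5 → 1 := fun ⟨_, _, h⟩ => h.1
  tfae_have 1 → 4 := fun h => ⟨_, _, h.base⟩
  tfae_have 4 → 3 := fun ⟨Y, B, h⟩ => ⟨Y, B, h.1⟩
  tfae_have 3 → 2 := fun ⟨Y, B, h⟩ => ⟨Y, B, h.1⟩
  tfae_have 2 → 1 := fun ⟨_, _, h⟩ => h.kolmogorov
  tfae_finish
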